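/- **Theorem 8.10.** Conventions. For a finite set $X$, $M_X$ is the algebra of complex $X\times X$ matrices with matrix units $e_xe_{x'}^*$, and $M_{XY}=M_X\otimes M_Y$. A *trace* on a unital C*-algebra is a tracial state. A *state* in $M_{ZZ}$ is a positive matrix of trace one. A *QNS correlation* $\Gamma:M_{XX}\to M_{AA}$ is a completely positive trace preserving linear map such that $(\mathrm{Tr}\otimes\mathrm{id})\,\Gamma(\rho\otimes\sigma)=0$ whenever $\mathrm{Tr}\,\rho=0$, and $(\mathrm{id}\otimes\mathrm{Tr})\,\Gamma(\rho\otimes\sigma)=0$ whenever $\mathrm{Tr}\,\sigma=0$. *The algebra $\mathcal C_{X,A}$.* Let $\mathcal V_{X,A}$ be the universal ternary ring of operators generated by elements $v_{a,x}$ ($x\in X$, $a\in A$) subject to $\sum_{a}v_{a,x}^*v_{a,x'}=\delta_{x,x'}1$, that is, the one generated by $\bigoplus_V V_{a,x}$, where $V=(V_{a,x})_{a,x}$ runs over all block operator isometries $H^X\to K^A$ between Hilbert spaces. Then $\mathcal C_{X,A}$ is its right C*-algebra, the closed linear span of $\{S^*T: S,T\in\mathcal V_{X,A}\}$; it is generated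 by the elements $e_{x,x',a,a'}=v_{a,x}^*v_{a',x'}$. *Tracial correlations.* For a trace $\tau$ on $\mathcal C_{X,A}$, let $\Gamma_\tau:M_{XX}\to M_{AA}$ be the linear map with $$\Gamma_\tau(e_xe_{x'}^*\otimes e_ye_{y'}^*)=\sum_{a,a',b,b'\in A}\tau(e_{x,x',a,a'}\,e_{y',y,b',b})\;e_ae_{a'}^*\otimes e_be_{b'}^*.$$ A QNS correlation $\Gamma:M_{XX}\to M_{AA}$ is *tracial* if $\Gamma=\Gamma_\tau$ for some trace $\tau$ on $\mathcal C_{X,A}$; it is *quantum tracial* (resp. *locally tracial*) if $\Gamma=\Gamma_{\tau_{\mathcal A}\circ\pi}$ for some finite dimensional (resp. abelian) unital C*-algebra $\mathcal A$, some trace $\tau_{\mathcal A}$ (resp. state $\tau_{\mathcal A}$) on $\mathcal A$ and some unital *-homomorphism $\pi:\mathcal C_{X,A}\to\mathcal A$. *Reciprocal states.* For a finite set $Z$ and a unital C*-algebra $\mathcal A$, a *stochastic $\mathcal A$-matrix* over $Z$ is a positive element $E=(g_{z,z'})_{z,z'}\in M_Z\otimes\mathcal A$ with $\sum_{z}g_{z,z}=1$.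 For a trace $\tau$ on $\mathcal A$, put $$\omega^{E,\tau}=\sum_{z,z',u,u'\in Z}\tau(g_{z,z'}\,g_{u',u})\;e_ze_{z'}^*\otimes e_ue_{u'}^*\in M_{ZZ}.$$ A state $\omega\in M_{ZZ}$ is *C\*-reciprocal* if $\omega=\omega^{E,\tau}$ for some unital C*-algebra $\mathcal A$, some trace $\tau$ on $\mathcal A$ and some stochastic $\mathcal A$-matrix $E$ over $Z$; it is *quantum reciprocal* (resp. *locally reciprocal*) if $\mathcal A$ can be chosen finite dimensional (resp. abelian). The sets of these states are denoted by $\Upsilon(Z)$, $\Upsilon_{\rm q}(Z)$ and $\Upsilon_{\rm loc}(Z)$, respectively. **Statement.** Let $X$ and $A$ be finite sets and let $\Gamma:M_{XX}\to M_{AA}$ be a QNS correlation. (i) If $\Gamma$ is tracial, then $\Gamma(\Upsilon(X))\subseteq\Upsilon(A)$. (ii) If $\Gamma$ is quantum tracial, then $\Gamma(\Upsilon_{\rm q}(X))\subseteq\Upsilon_{\rm q}(A)$. (iii) If $\Gamma$ is locally tracial, then $\Gamma(\Upsilon_{\rm loc}(X))\subseteq\Upsilon_{\rm loc}(A)$.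 -/

import Mathlib

open scoped Kronecker ComplexOrder ENNReal InnerProductSpace

universe u

noncomputable section

namespace QNS

/-! ### Quantum channels, no-signalling correlations and states of matrix algebras

For a finite set `X`, `Matrix X X ℂ` is `M_X`, and `M_X ⊗ M_Y` is identified with
`Matrix (X × Y) (X × Y) ℂ`, so that `e_x e_{x'}^* ⊗ e_y e_{y'}^*` is the matrix unit at the position
`(x, y), (x', y')`. -/

/-- Complete positivity: every amplification `id_n ⊗ Φ` maps positive matrices to positive
matrices. -/
def IsCompletelyPositive {X A : Type u} [Fintype X] [Fintype A]
    (Φ : Matrix X X ℂ →ₗ[ℂ] Matrix A A ℂ) : Prop :=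
  ∀ (n : ℕ) (P : Matrix (Fin n × X) (Fin n × X) ℂ), P.PosSemidef →
    (Matrix.of fun i j : Fin n × A =>
      Φ (Matrix.of fun x x' => P (i.1, x) (j.1, x')) i.2 j.2).PosSemidef

/-- Quantum channels: completely positive trace preserving maps. -/
structure IsQuantumChannel {X A : Type u} [Fintype X] [Fintype A]
    (Φ : Matrix X X ℂ →ₗ[ℂ] Matrix A A ℂ) : Prop where
  completelyPositive : IsCompletelyPositive Φ
  trace_preserving : ∀ ρ, (Φ ρ).trace = ρ.trace

/-- The partial trace `Tr_A : M_{AB} → M_B`. -/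
def partialTraceLeft {A B : Type u} [Fintype A] (T : Matrix (A × B) (A × B) ℂ) : Matrix B B ℂ :=
  Matrix.of fun b b' => ∑ a, T (a, b) (a, b')

/-- The partial trace `Tr_B : M_{AB} → M_A`. -/
def partialTraceRight {A B : Type u} [Fintype B] (T : Matrix (A × B) (A × B) ℂ) : Matrix A A ℂ :=
  Matrix.of fun a a' => ∑ b, T (a, b) (a', b)

/-- Quantum no-signalling (QNS) correlations `Γ : M_{XY} → M_{AB}`. -/
structure IsQNSCorrelation {X Y A B : Type u} [Fintype X] [Fintype Y] [Fintype A] [Fintype B]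
    (Γ : Matrix (X × Y) (X × Y) ℂ →ₗ[ℂ] Matrix (A × B) (A × B) ℂ) : Prop where
  isQuantumChannel : IsQuantumChannel Γ
  noSignalling_left : ∀ (ρ : Matrix X X ℂ) (σ : Matrix Y Y ℂ), ρ.trace = 0 →
    partialTraceLeft (Γ (ρ ⊗ₖ σ)) = 0
  noSignalling_right : ∀ (ρ : Matrix X X ℂ) (σ : Matrix Y Y ℂ), σ.trace = 0 →
    partialTraceRight (Γ (ρ ⊗ₖ σ)) = 0

/-- States of a matrix algebra, given by their density matrices. -/
def IsMatrixState {Z : Type u} [Fintype Z] (ω : Matrix Z Z ℂ) : Prop :=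
  ω.PosSemidef ∧ ω.trace = 1

/-! ### States and traces of C*-algebras, stochastic matrices -/

/-- States of a unital C*-algebra: unital positive functionals. -/
structure IsState {𝒜 : Type u} [CStarAlgebra 𝒜] (τ : 𝒜 →ₗ[ℂ] ℂ) : Prop where
  map_one : τ 1 = 1
  nonneg : ∀ a, 0 ≤ τ (star a * a)

/-- Traces of a unital C*-algebra: tracial states. -/
structure IsTrace {𝒜 : Type u} [CStarAlgebra 𝒜] (τ : 𝒜 →ₗ[ℂ] ℂ) : Prop where
  isState : IsState τ
  map_mul_comm : ∀ a b, τ (a * b) = τ (b * a)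

/-- Stochastic `𝒜`-matrices `E = (g_{z,z'}) ∈ M_Z ⊗ 𝒜`: positive elements of the C*-algebra
`M_Z ⊗ 𝒜` (that is, elements of the form `D^* D`) with `∑_z g_{z,z} = 1`. -/
structure IsStochasticMatrix {Z 𝒜 : Type u} [Fintype Z] [CStarAlgebra 𝒜] (E : Matrix Z Z 𝒜) :
    Prop where
  positive : ∃ D : Matrix Z Z 𝒜, E = D.conjTranspose * D
  trace_eq_one : E.trace = 1

/-! ### The C*-algebra `C_{X,A}` -/

/-- A separable infinite dimensional Hilbert space. -/
abbrev Hilb : Type := lp (fun _ : ℕ => ℂ) 2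

instance : Nontrivial Hilb :=
  ⟨⟨lp.single 2 0 1, 0, fun h => by
    have := congrArg (fun f : Hilb => f 0) h
    simp at this⟩⟩

/-- A representation `V = (V_{a,x})_{a,x}` of the relations
`∑_a V_{a,x}^* V_{a,x'} = δ_{x,x'} I`, that is, a block operator isometry `H^X → K^A`. We fix
`H = K = ℓ²`; since an arbitrary representation is a direct sum of separable ones, and separable ones
can be amplified by infinite multiplicity, these representations determine the universal norm. -/
structure BlockIsometry (X A : Type u) [Fintype X] [Fintype A] where
  V : A → X → Hilb →L[ℂ] Hilb
  sum_same : ∀ x, ∑ a, star (V a x) * V a x = 1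
  sum_ne : ∀ x x', x ≠ x' → ∑ a, star (V a x) * V a x' = 0

theorem BlockIsometry.norm_le_one {X A : Type u} [Fintype X] [Fintype A] (V : BlockIsometry X A)
    (a : A) (x : X) : ‖V.V a x‖ ≤ 1 := by
  refine ContinuousLinearMap.opNorm_le_bound _ zero_le_one fun ξ => ?_
  have h := congrArg (fun T : Hilb →L[ℂ] Hilb => RCLike.re ⟪ξ, T ξ⟫_ℂ) (V.sum_same x)
  have h2 : ∑ b, ‖V.V b x ξ‖ ^ 2 = ‖ξ‖ ^ 2 := by
    simpa [sum_apply, inner_sum, ContinuousLinearMap.star_eq_adjoint,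
      ContinuousLinearMap.adjoint_inner_right, inner_self_eq_norm_sq_to_K, ← Complex.ofReal_pow]
      using h
  have h3 : ‖V.V a x ξ‖ ^ 2 ≤ ‖ξ‖ ^ 2 := h2 ▸
    Finset.single_le_sum (f := fun b => ‖V.V b x ξ‖ ^ 2) (fun b _ => by positivity)
      (Finset.mem_univ a)
  rw [one_mul]
  exact le_of_sq_le_sq h3 (norm_nonneg _)

/-- The bounded families `(T_V)_V` of operators, indexed by all representations `V`; that is, the
block diagonal operators on `⊕_V H_V`. -/
abbrev BlockDiagonal (X A : Type u) [Fintype X] [Fintype A] : Type u :=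
  lp (fun _ : BlockIsometry X A => Hilb →L[ℂ] Hilb) ∞

instance (X A : Type u) [Fintype X] [Fintype A] : CStarAlgebra (BlockDiagonal X A) where

/-- The element `e_{x,x',a,a'} = v_{a,x}^* v_{a',x'}`, where `v_{a,x} = ⊕_V V_{a,x}`. -/
def unitBlock {X A : Type u} [Fintype X] [Fintype A] (x x' : X) (a a' : A) : BlockDiagonal X A :=
  ⟨fun V => star (V.V a x) * V.V a' x', memℓp_infty ⟨1, by
    rintro _ ⟨V, rfl⟩
    refine (norm_mul_le _ _).trans ?_
    exact mul_le_one₀ ((norm_star (V.V a x)).trans_le (V.norm_le_one a x)) (norm_nonneg _)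
      (V.norm_le_one a' x')⟩⟩

/-- The C*-algebra generated by the elements `e_{x,x',a,a'}`. It is the closed linear span of the
products `S^* T`, where `S` and `T` run over the ternary ring of operators generated by the
`v_{a,x}`. -/
def brownCuntz (X A : Type u) [Fintype X] [Fintype A] : StarSubalgebra ℂ (BlockDiagonal X A) :=
  (StarAlgebra.adjoin ℂ
    {T | ∃ (x x' : X) (a a' : A), T = unitBlock x x' a a'}).topologicalClosure

/-- The C*-algebra `C_{X,A}`, the right C*-algebra of the universal ternary ring of operators
generated by elements `v_{a,x}` with `∑_a v_{a,x}^* v_{a,x'} = δ_{x,x'} 1`. -/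
def BrownCuntz (X A : Type u) [Fintype X] [Fintype A] : Type u := brownCuntz X A

instance (X A : Type u) [Fintype X] [Fintype A] : CStarAlgebra (BrownCuntz X A) :=
  StarSubalgebra.cstarAlgebra (brownCuntz X A)
    (h_closed := StarSubalgebra.isClosed_topologicalClosure _)

/-- The canonical generators `e_{x,x',a,a'}` of `C_{X,A}`. -/
def gen {X A : Type u} [Fintype X] [Fintype A] (x x' : X) (a a' : A) : BrownCuntz X A :=
  ⟨unitBlock x x' a a', StarSubalgebra.le_topologicalClosure _
    (StarAlgebra.subset_adjoin ℂ _ ⟨x, x', a, a', rfl⟩)⟩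

/-! ### Tracial correlations and reciprocal states -/

/-- The map `Γ_τ : M_{XX} → M_{AA}`, which sends `e_x e_{x'}^* ⊗ e_y e_{y'}^*` to
`∑_{a,a',b,b'} τ(e_{x,x',a,a'} e_{y',y,b',b}) e_a e_{a'}^* ⊗ e_b e_{b'}^*`. -/
def tracialMap {X A : Type u} [Fintype X] [Fintype A] (τ : BrownCuntz X A →ₗ[ℂ] ℂ) :
    Matrix (X × X) (X × X) ℂ →ₗ[ℂ] Matrix (A × A) (A × A) ℂ where
  toFun ρ := Matrix.of fun p q =>
    ∑ x, ∑ x', ∑ y, ∑ y', ρ (x, y) (x', y') * τ (gen x x' p.1 q.1 * gen y' y q.2 p.2)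
  map_add' ρ σ := by
    ext p q
    simp [add_mul, Finset.sum_add_distrib]
  map_smul' c ρ := by
    ext p q
    simp [Finset.mul_sum, mul_assoc]

section Tracial

variable {X A : Type u} [Fintype X] [Fintype A]
  (Γ : Matrix (X × X) (X × X) ℂ →ₗ[ℂ] Matrix (A × A) (A × A) ℂ)

/-- Tracial QNS correlations. -/
def IsTracial : Prop :=
  IsQNSCorrelation Γ ∧ ∃ τ : BrownCuntz X A →ₗ[ℂ] ℂ, IsTrace τ ∧ Γ = tracialMap τ

/-- Quantum tracial QNS correlations: the trace factors through a finite dimensional C*-algebra. -/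
def IsQuantumTracial : Prop :=
  IsQNSCorrelation Γ ∧ ∃ (𝒜 : Type u) (_ : CStarAlgebra 𝒜) (τ : 𝒜 →ₗ[ℂ] ℂ)
    (π : BrownCuntz X A →⋆ₐ[ℂ] 𝒜), FiniteDimensional ℂ 𝒜 ∧ IsTrace τ ∧
      Γ = tracialMap (τ ∘ₗ π.toAlgHom.toLinearMap)

/-- Locally tracial QNS correlations: the trace factors through an abelian C*-algebra. -/
def IsLocallyTracial : Prop :=
  IsQNSCorrelation Γ ∧ ∃ (𝒜 : Type u) (_ : CStarAlgebra 𝒜) (τ : 𝒜 →ₗ[ℂ] ℂ)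
    (π : BrownCuntz X A →⋆ₐ[ℂ] 𝒜), (∀ u v : 𝒜, u * v = v * u) ∧ IsState τ ∧
      Γ = tracialMap (τ ∘ₗ π.toAlgHom.toLinearMap)

end Tracial

/-- The matrix `ω^{E,τ} ∈ M_{ZZ}`, `E = (g_{z,z'})`, whose coefficient at
`e_z e_{z'}^* ⊗ e_u e_{u'}^*` is `τ(g_{z,z'} g_{u',u})`. -/
def reciprocalMatrix {Z 𝒜 : Type u} [CStarAlgebra 𝒜] (E : Matrix Z Z 𝒜) (τ : 𝒜 →ₗ[ℂ] ℂ) :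
    Matrix (Z × Z) (Z × Z) ℂ :=
  Matrix.of fun p q => τ (E p.1 q.1 * E q.2 p.2)

/-- `Υ(Z)`: the C*-reciprocal states in `M_{ZZ}`. -/
def reciprocalStates (Z : Type u) [Fintype Z] : Set (Matrix (Z × Z) (Z × Z) ℂ) :=
  {ω | IsMatrixState ω ∧ ∃ (𝒜 : Type u) (_ : CStarAlgebra 𝒜) (τ : 𝒜 →ₗ[ℂ] ℂ) (E : Matrix Z Z 𝒜),
    IsTrace τ ∧ IsStochasticMatrix E ∧ ω = reciprocalMatrix E τ}

/-- `Υ_q(Z)`: the quantum reciprocal states in `M_{ZZ}`. -/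
def quantumReciprocalStates (Z : Type u) [Fintype Z] : Set (Matrix (Z × Z) (Z × Z) ℂ) :=
  {ω | IsMatrixState ω ∧ ∃ (𝒜 : Type u) (_ : CStarAlgebra 𝒜) (τ : 𝒜 →ₗ[ℂ] ℂ) (E : Matrix Z Z 𝒜),
    FiniteDimensional ℂ 𝒜 ∧ IsTrace τ ∧ IsStochasticMatrix E ∧ ω = reciprocalMatrix E τ}

/-- `Υ_loc(Z)`: the locally reciprocal states in `M_{ZZ}`. -/
def locallyReciprocalStates (Z : Type u) [Fintype Z] : Set (Matrix (Z × Z) (Z × Z) ℂ) :=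
  {ω | IsMatrixState ω ∧ ∃ (𝒜 : Type u) (_ : CStarAlgebra 𝒜) (τ : 𝒜 →ₗ[ℂ] ℂ) (E : Matrix Z Z 𝒜),
    (∀ u v : 𝒜, u * v = v * u) ∧ IsTrace τ ∧ IsStochasticMatrix E ∧ ω = reciprocalMatrix E τ}

end QNS

end

noncomputable section

namespace QNS

/-! ### Positive matrices over C*-algebras -/

/-! Write `Γ = Γ_{τ₂ ∘ π}` and `ω = ω^{E,τ₁}` with `E = (g_{x,x'})`. The coefficients of `Γ(ω)` are
sums of products `τ₁(g_{x,x'} g_{y',y}) τ₂(π(e_{x,x',a,a'} e_{y',y,b',b}))`, that is, the values of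
`τ₁ ⊗ τ₂` at `h_{a,a'} h_{b',b}`, where `h_{a,a'} = ∑ g_{x,x'} ⊗ π(e_{x,x',a,a'})`
(`tracialMap_reciprocalMatrix`). So `Γ(ω)` is reciprocal once `h` is stochastic
(`isStochasticMatrix_imageMatrix`): `h` is positive because `E` and `(e_{x,x',a,a'})` are Gram
matrices and the two tensor factors commute, and its diagonal sums to `1` because `∑_a e_{x,x',a,a}
= δ_{x,x'} 1`.

The tensor product is realised spatially (`exists_tensor_trace`): the GNS representations of both
traces are amplified to the tensor product of their Hilbert spaces, and the vector state at `ξ₁ ⊗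
ξ₂` is restricted to the closed span of the products. The resulting algebra is finite dimensional,
or abelian, if both factors are, so one construction serves all three cases. -/

theorem exists_eq_star_mul_self_of_nonneg {𝒜 : Type*} [CStarAlgebra 𝒜] [PartialOrder 𝒜]
    [StarOrderedRing 𝒜] {a : 𝒜} (ha : 0 ≤ a) : ∃ b, a = star b * b :=
  CStarAlgebra.nonneg_iff_eq_star_mul_self.mp ha

/-- The Gram matrix of a finite family of rows is of the form `D^* D` with `D` square. -/
theorem exists_conjTranspose_mul_self_eq_gram {ι n 𝒜 : Type*} [Fintype ι] [Fintype n]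
    [CStarAlgebra 𝒜] (W : ι → n → 𝒜) :
    ∃ D : Matrix n n 𝒜, (Matrix.of fun i j => ∑ k, star (W k i) * W k j) = D.conjTranspose * D := by
  classical
  let _ : PartialOrder 𝒜 := CStarAlgebra.spectralOrder 𝒜
  have _ : StarOrderedRing 𝒜 := CStarAlgebra.spectralOrderedRing 𝒜
  -- A row index `i₀` is needed to place each row of `W` inside a square matrix.
  rcases isEmpty_or_nonempty n with hn | ⟨⟨i₀⟩⟩
  · exact ⟨0, Subsingleton.elim _ _⟩
  let P : ι → CStarMatrix n n 𝒜 := fun k => CStarMatrix.ofMatrix (Matrix.of fun i j => star (W k i) * W k j)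
  have hP : ∀ k, 0 ≤ P k := fun k => by
    -- With `W k` as row `i₀` and zeros elsewhere, `S^* S` is the rank-one Gram matrix `P k`.
    let S : CStarMatrix n n 𝒜 := CStarMatrix.ofMatrix (Matrix.of fun i j => if i = i₀ then W k j else 0)
    have : P k = star S * S := by
      refine CStarMatrix.ext fun i j => ?_
      rw [CStarMatrix.mul_apply]
      have hS : ∀ l m, S l m = if l = i₀ then W k m else 0 := fun _ _ => rfl
      simp only [CStarMatrix.star_apply, hS]
      rw [Finset.sum_eq_single i₀ (fun b _ hb => by simp [hb]) (by simp), if_pos rfl, if_pos rfl]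
      rfl
    rw [this]
    exact star_mul_self_nonneg S
  obtain ⟨D, hD⟩ := exists_eq_star_mul_self_of_nonneg
    (Finset.sum_nonneg fun k (_ : k ∈ Finset.univ) => hP k)
  refine ⟨CStarMatrix.ofMatrix.symm D, ?_⟩
  ext i j
  have h := congrArg (CStarMatrix.ofMatrixₗ (R := ℂ) (m := n) (n := n) (A := 𝒜)).symm hD
  rw [map_sum] at h
  have h := congrFun (congrFun h i) j
  rw [Matrix.sum_apply] at h
  exact h

/-- An injective *-homomorphism reflects positivity of self-adjoint elements. -/
theorem nonneg_of_map_nonneg {𝒜 ℬ : Type*} [CStarAlgebra 𝒜] [PartialOrder 𝒜] [StarOrderedRing 𝒜]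
    [CStarAlgebra ℬ] [PartialOrder ℬ] [StarOrderedRing ℬ] (φ : 𝒜 →⋆ₐ[ℂ] ℬ)
    (hφ : Function.Injective φ) {a : 𝒜} (ha : 0 ≤ φ a) : 0 ≤ a := by
  have hsa : IsSelfAdjoint a := hφ (by rw [map_star]; exact ha.isSelfAdjoint)
  -- Functional calculus commutes with `φ`, and `|·|` is the identity on the spectrum of `φ a`;
  -- injectivity then gives `a = |a|`.
  have h : φ (cfc (fun x : ℝ => |x|) a) = φ a := by
    have hcont : Continuous φ := map_continuous φ
    rw [StarAlgHom.map_cfc φ (fun x : ℝ => |x|) a (by fun_prop) hcont hsa ha.isSelfAdjoint]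
    conv_rhs => rw [← cfc_id ℝ (φ a) ha.isSelfAdjoint]
    exact cfc_congr fun x hx => abs_of_nonneg (spectrum_nonneg_of_nonneg ha hx)
  rw [← hφ h]
  exact cfc_nonneg fun x _ => abs_nonneg x

/-- Applying `φ` entrywise is an injective *-homomorphism of matrix algebras, so positivity is
reflected. This moves a factorization found in a larger algebra into the smaller one. -/
theorem exists_conjTranspose_mul_self_of_map {n 𝒜 ℬ : Type*} [Fintype n] [CStarAlgebra 𝒜]
    [CStarAlgebra ℬ] (φ : 𝒜 →⋆ₐ[ℂ] ℬ) (hφ : Function.Injective φ) {M : Matrix n n 𝒜}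
    {D : Matrix n n ℬ} (h : M.map φ = D.conjTranspose * D) :
    ∃ F : Matrix n n 𝒜, M = F.conjTranspose * F := by
  classical
  let _ : PartialOrder 𝒜 := CStarAlgebra.spectralOrder 𝒜
  have _ : StarOrderedRing 𝒜 := CStarAlgebra.spectralOrderedRing 𝒜
  let _ : PartialOrder ℬ := CStarAlgebra.spectralOrder ℬ
  have _ : StarOrderedRing ℬ := CStarAlgebra.spectralOrderedRing ℬ
  let Φ : CStarMatrix n n 𝒜 →⋆ₐ[ℂ] CStarMatrix n n ℬ :=
    { toFun := fun N => N.map φ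
      map_one' := Matrix.map_one φ (map_zero φ) (map_one φ)
      map_mul' := fun N N' => Matrix.map_mul (L := N) (M := N') (f := φ)
      map_zero' := Matrix.map_zero φ (map_zero φ)
      map_add' := fun N N' => Matrix.map_add φ (map_add φ) N N'
      commutes' := fun c => by
        refine CStarMatrix.ext fun i j => ?_
        by_cases hij : i = j <;>
          simp [CStarMatrix.algebraMap_apply, hij, AlgHomClass.commutes]
      map_star' := fun N => by
        refine CStarMatrix.ext fun i j => ?_
        simp [CStarMatrix.star_apply, map_star] }
  have hΦ : Function.Injective Φ := CStarMatrix.map_injective hφ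
  have h0 : 0 ≤ Φ (CStarMatrix.ofMatrix M) := by
    have : Φ (CStarMatrix.ofMatrix M) = star (CStarMatrix.ofMatrix D) * CStarMatrix.ofMatrix D := h
    rw [this]
    exact star_mul_self_nonneg _
  obtain ⟨F, hF⟩ := exists_eq_star_mul_self_of_nonneg (nonneg_of_map_nonneg Φ hΦ h0)
  exact ⟨CStarMatrix.ofMatrix.symm F, hF⟩

/-! ### The tensor product of two C*-algebras with traces -/
section Amplification

variable (H G : Type u) [NormedAddCommGroup H] [InnerProductSpace ℂ H]
  [NormedAddCommGroup G] [InnerProductSpace ℂ G]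

open scoped TensorProduct
open UniformSpace

/-- The Hilbert space tensor product. -/
abbrev HilbertTensor : Type u := Completion (H ⊗[ℂ] G)

variable {H G}

theorem HilbertTensor.clm_ext {S T : HilbertTensor H G →L[ℂ] HilbertTensor H G}
    (h : ∀ x y, S ((x ⊗ₜ[ℂ] y : H ⊗[ℂ] G) : HilbertTensor H G) =
      T ((x ⊗ₜ[ℂ] y : H ⊗[ℂ] G) : HilbertTensor H G)) : S = T := by
  ext z
  induction z using Completion.induction_on with
  | hp => exact isClosed_eq S.continuous T.continuous
  | ih z =>
    induction z using TensorProduct.induction_on with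
    | zero => rw [Completion.coe_zero, map_zero, map_zero]
    | tmul x y => exact h x y
    | add z w hz hw => rw [Completion.coe_add, map_add, map_add, hz, hw]

/-- Elementary tensors have dense span, and both sides are sesquilinear and continuous. -/
theorem HilbertTensor.eq_adjoint {S T : HilbertTensor H G →L[ℂ] HilbertTensor H G}
    (h : ∀ x y x' y', ⟪S ((x ⊗ₜ[ℂ] y : H ⊗[ℂ] G) : HilbertTensor H G),
        ((x' ⊗ₜ[ℂ] y' : H ⊗[ℂ] G) : HilbertTensor H G)⟫_ℂ =
      ⟪((x ⊗ₜ[ℂ] y : H ⊗[ℂ] G) : HilbertTensor H G),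
        T ((x' ⊗ₜ[ℂ] y' : H ⊗[ℂ] G) : HilbertTensor H G)⟫_ℂ) : S = star T := by
  refine (ContinuousLinearMap.eq_adjoint_iff S T).mpr fun z w => ?_
  induction z, w using Completion.induction_on₂ with
  | hp => apply isClosed_eq <;> fun_prop
  | ih z w =>
    induction z using TensorProduct.induction_on with
    | zero => rw [Completion.coe_zero, map_zero, inner_zero_left, inner_zero_left]
    | add z z' hz hz' => simp only [Completion.coe_add, map_add, inner_add_left, hz, hz']
    | tmul x y =>
      induction w using TensorProduct.induction_on with
      | zero => rw [Completion.coe_zero, map_zero, inner_zero_right, inner_zero_right]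
      | add w w' hw hw' => simp only [Completion.coe_add, map_add, inner_add_right, hw, hw']
      | tmul x' y' => exact h x y x' y'

variable (H G)

/-- The amplification `T ↦ T ⊗ 1`. -/
def ampLeft [CompleteSpace H] : (H →L[ℂ] H) →⋆ₐ[ℂ] (HilbertTensor H G →L[ℂ] HilbertTensor H G) where
  toFun T := (T.rTensor G).completion
  map_one' := HilbertTensor.clm_ext fun x y => by simp
  map_mul' S T := HilbertTensor.clm_ext fun x y => by simp
  map_zero' := HilbertTensor.clm_ext fun x y => by simp
  map_add' S T := HilbertTensor.clm_ext fun x y => by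
    simp [Completion.coe_add]
  commutes' c := HilbertTensor.clm_ext fun x y => by
    simp [Algebra.algebraMap_eq_smul_one]
  map_star' T := HilbertTensor.eq_adjoint fun x y x' y' => by
    simp [ContinuousLinearMap.star_eq_adjoint, ContinuousLinearMap.adjoint_inner_left]

/-- The amplification `T ↦ 1 ⊗ T`. -/
def ampRight [CompleteSpace G] : (G →L[ℂ] G) →⋆ₐ[ℂ] (HilbertTensor H G →L[ℂ] HilbertTensor H G) where
  toFun T := (T.lTensor H).completion
  map_one' := HilbertTensor.clm_ext fun x y => by simp
  map_mul' S T := HilbertTensor.clm_ext fun x y => by simp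
  map_zero' := HilbertTensor.clm_ext fun x y => by simp
  map_add' S T := HilbertTensor.clm_ext fun x y => by
    simp [Completion.coe_add]
  commutes' c := HilbertTensor.clm_ext fun x y => by
    simp [Algebra.algebraMap_eq_smul_one]
  map_star' T := HilbertTensor.eq_adjoint fun x y x' y' => by
    simp [ContinuousLinearMap.star_eq_adjoint, ContinuousLinearMap.adjoint_inner_left]

variable {H G}

@[simp]
theorem ampLeft_apply_tmul [CompleteSpace H] (T : H →L[ℂ] H) (x : H) (y : G) :
    ampLeft H G T ((x ⊗ₜ[ℂ] y : H ⊗[ℂ] G) : HilbertTensor H G) =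
      ((T x ⊗ₜ[ℂ] y : H ⊗[ℂ] G) : HilbertTensor H G) := by
  simp [ampLeft]

@[simp]
theorem ampRight_apply_tmul [CompleteSpace G] (T : G →L[ℂ] G) (x : H) (y : G) :
    ampRight H G T ((x ⊗ₜ[ℂ] y : H ⊗[ℂ] G) : HilbertTensor H G) =
      ((x ⊗ₜ[ℂ] T y : H ⊗[ℂ] G) : HilbertTensor H G) := by
  simp [ampRight]

theorem commute_ampLeft_ampRight [CompleteSpace H] [CompleteSpace G] (S : H →L[ℂ] H)
    (T : G →L[ℂ] G) :
    Commute (ampLeft H G S) (ampRight H G T) :=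
  HilbertTensor.clm_ext fun x y => by simp

end Amplification

/-- The cyclic representation of a state. -/
theorem IsState.exists_cyclic_representation {𝒜 : Type u} [CStarAlgebra 𝒜] {τ : 𝒜 →ₗ[ℂ] ℂ}
    (hτ : IsState τ) :
    ∃ (H : Type u) (_ : NormedAddCommGroup H) (_ : InnerProductSpace ℂ H) (_ : CompleteSpace H)
      (π : 𝒜 →⋆ₐ[ℂ] (H →L[ℂ] H)) (ξ : H), ∀ a, ⟪ξ, π a ξ⟫_ℂ = τ a := by
  let _ : PartialOrder 𝒜 := CStarAlgebra.spectralOrder 𝒜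
  have _ : StarOrderedRing 𝒜 := CStarAlgebra.spectralOrderedRing 𝒜
  let f : 𝒜 →ₚ[ℂ] ℂ := PositiveLinearMap.mk₀ τ fun a ha => by
    obtain ⟨b, rfl⟩ := exists_eq_star_mul_self_of_nonneg ha
    exact hτ.nonneg b
  -- The vector is the class of `1` in the GNS space.
  refine ⟨f.GNS, inferInstance, inferInstance, inferInstance, f.gnsStarAlgHom,
    ((f.toPreGNS 1 : f.PreGNS) : f.GNS), fun a => ?_⟩
  change ⟪((f.toPreGNS 1 : f.PreGNS) : f.GNS),
    f.gnsNonUnitalStarAlgHom a ((f.toPreGNS 1 : f.PreGNS) : f.GNS)⟫_ℂ = τ a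
  rw [PositiveLinearMap.gnsNonUnitalStarAlgHom_apply_coe, UniformSpace.Completion.inner_coe,
    PositiveLinearMap.preGNS_inner_def]
  simp only [PositiveLinearMap.leftMulMapPreGNS_apply, PositiveLinearMap.ofPreGNS_toPreGNS,
    star_one, one_mul, mul_one]
  rfl

/-! ### The C*-algebra generated by two commuting *-homomorphic images. -/

section StarRange

variable {𝒜₁ 𝒜₂ ℬ : Type u} [CStarAlgebra 𝒜₁] [CStarAlgebra 𝒜₂] [CStarAlgebra ℬ]
  (ρ₁ : 𝒜₁ →⋆ₐ[ℂ] ℬ) (ρ₂ : 𝒜₂ →⋆ₐ[ℂ] ℬ) (h : ∀ a b, Commute (ρ₁ a) (ρ₂ b))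

open scoped TensorProduct

/-- The homomorphism `a ⊗ b ↦ ρ₁(a) ρ₂(b)` defined by *-homomorphisms with commuting ranges. -/
def tensorLift : 𝒜₁ ⊗[ℂ] 𝒜₂ →ₐ[ℂ] ℬ :=
  Algebra.TensorProduct.lift ρ₁.toAlgHom ρ₂.toAlgHom h

@[simp]
theorem tensorLift_tmul (a : 𝒜₁) (b : 𝒜₂) : tensorLift ρ₁ ρ₂ h (a ⊗ₜ b) = ρ₁ a * ρ₂ b := rfl

/-- The *-algebra spanned by the products `ρ₁(a) ρ₂(b)`. -/
def tensorRange : StarSubalgebra ℂ ℬ where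
  toSubalgebra := (tensorLift ρ₁ ρ₂ h).range
  star_mem' := by
    rintro _ ⟨t, rfl⟩
    induction t using TensorProduct.induction_on with
    | zero => exact ⟨0, by simp⟩
    | tmul a b =>
      refine ⟨star a ⊗ₜ star b, ?_⟩
      simpa [map_star] using (h (star a) (star b)).eq
    | add s t hs ht =>
      obtain ⟨s', hs⟩ := hs
      obtain ⟨t', ht⟩ := ht
      exact ⟨s' + t', by simp_all⟩

/-- The C*-algebra generated by the ranges of `ρ₁` and `ρ₂`. -/
def tensorClosure : StarSubalgebra ℂ ℬ := (tensorRange ρ₁ ρ₂ h).topologicalClosure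

instance : CStarAlgebra (tensorClosure ρ₁ ρ₂ h) :=
  StarSubalgebra.cstarAlgebra (tensorClosure ρ₁ ρ₂ h)
    (h_closed := StarSubalgebra.isClosed_topologicalClosure _)

variable {ρ₁ ρ₂ h}

theorem left_mem_tensorClosure (a : 𝒜₁) : ρ₁ a ∈ tensorClosure ρ₁ ρ₂ h :=
  StarSubalgebra.le_topologicalClosure _ ⟨a ⊗ₜ 1, by simp⟩

theorem right_mem_tensorClosure (b : 𝒜₂) : ρ₂ b ∈ tensorClosure ρ₁ ρ₂ h :=
  StarSubalgebra.le_topologicalClosure _ ⟨1 ⊗ₜ b, by simp⟩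

/-- Density argument in two variables at once: a closed biadditive condition needs checking only on
products `ρ₁(a) ρ₂(b)`. It yields both commutativity and the trace property. -/
theorem tensorClosure_induction₂ {p : ℬ → ℬ → Prop}
    (hp : IsClosed {q : ℬ × ℬ | p q.1 q.2})
    (mul : ∀ a b a' b', p (ρ₁ a * ρ₂ b) (ρ₁ a' * ρ₂ b'))
    (zero_left : ∀ T, p 0 T) (zero_right : ∀ T, p T 0)
    (add_left : ∀ S S' T, p S T → p S' T → p (S + S') T)
    (add_right : ∀ S T T', p S T → p S T' → p S (T + T'))
    {S T : ℬ} (hS : S ∈ tensorClosure ρ₁ ρ₂ h) (hT : T ∈ tensorClosure ρ₁ ρ₂ h) : p S T := by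
  have key : ∀ s t, p (tensorLift ρ₁ ρ₂ h s) (tensorLift ρ₁ ρ₂ h t) := fun s t => by
    induction s using TensorProduct.induction_on with
    | zero => simpa using zero_left _
    | add s s' hs hs' => simpa using add_left _ _ _ hs hs'
    | tmul a b =>
      induction t using TensorProduct.induction_on with
      | zero => simpa using zero_right _
      | add t t' ht ht' => simpa using add_right _ _ _ ht ht'
      | tmul a' b' => exact mul a b a' b'
  have hST : (S, T) ∈ closure ((tensorRange ρ₁ ρ₂ h : Set ℬ) ×ˢ (tensorRange ρ₁ ρ₂ h : Set ℬ)) := by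
    rw [closure_prod_eq]
    exact ⟨hS, hT⟩
  refine closure_minimal ?_ hp hST
  rintro ⟨_, _⟩ ⟨⟨s, rfl⟩, ⟨t, rfl⟩⟩
  exact key s t

theorem finiteDimensional_tensorClosure [FiniteDimensional ℂ 𝒜₁] [FiniteDimensional ℂ 𝒜₂] :
    FiniteDimensional ℂ (tensorClosure ρ₁ ρ₂ h) := by
  let V : Submodule ℂ ℬ := LinearMap.range (tensorLift ρ₁ ρ₂ h).toLinearMap
  -- A finite dimensional span is already closed, so taking the closure adds nothing.
  have hV : IsClosed (V : Set ℬ) := V.closed_of_finiteDimensional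
  have hle : Subalgebra.toSubmodule (tensorClosure ρ₁ ρ₂ h).toSubalgebra ≤ V :=
    fun T hT => closure_minimal (s := (tensorRange ρ₁ ρ₂ h : Set ℬ)) (fun _ h => h) hV hT
  exact Submodule.finiteDimensional_of_le hle

theorem mul_mul_mul_of_commute (h : ∀ a b, Commute (ρ₁ a) (ρ₂ b)) (a : 𝒜₁) (b : 𝒜₂) (a' : 𝒜₁)
    (b' : 𝒜₂) : (ρ₁ a * ρ₂ b) * (ρ₁ a' * ρ₂ b') = ρ₁ (a * a') * ρ₂ (b * b') := by
  rw [map_mul, map_mul, mul_assoc, ← mul_assoc (ρ₂ b), ← (h a' b).eq]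
  simp only [mul_assoc]

theorem mul_comm_of_mem_tensorClosure (c₁ : ∀ u v : 𝒜₁, u * v = v * u)
    (c₂ : ∀ u v : 𝒜₂, u * v = v * u) {S T : ℬ} (hS : S ∈ tensorClosure ρ₁ ρ₂ h)
    (hT : T ∈ tensorClosure ρ₁ ρ₂ h) : S * T = T * S := by
  refine tensorClosure_induction₂ (p := fun S T => S * T = T * S) ?_ ?_ ?_ ?_ ?_ ?_ hS hT
  · exact isClosed_eq (by fun_prop) (by fun_prop)
  · intro a b a' b'
    rw [mul_mul_mul_of_commute h, mul_mul_mul_of_commute h, c₁, c₂]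
  · simp
  · simp
  · intro S S' T h h'
    simp only [add_mul, mul_add, h, h']
  · intro S S' T h h'
    simp only [add_mul, mul_add, h, h']

/-- A state whose restriction to the products `ρ₁(a) ρ₂(b)` is the product of two traces is
a trace on the C*-algebra that they generate. -/
theorem isTrace_restrict_tensorClosure {τ₁ : 𝒜₁ →ₗ[ℂ] ℂ} {τ₂ : 𝒜₂ →ₗ[ℂ] ℂ} (h₁ : IsTrace τ₁)
    (h₂ : IsTrace τ₂) {φ : ℬ →L[ℂ] ℂ} (hφ : IsState φ.toLinearMap)
    (hφτ : ∀ a b, φ (ρ₁ a * ρ₂ b) = τ₁ a * τ₂ b) :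
    IsTrace (φ.toLinearMap ∘ₗ (tensorClosure ρ₁ ρ₂ h).subtype.toAlgHom.toLinearMap) := by
  refine ⟨⟨hφ.map_one, fun T => hφ.nonneg T.1⟩, fun S T => ?_⟩
  refine tensorClosure_induction₂ (h := h) (p := fun S T => φ (S * T) = φ (T * S))
    ?_ ?_ ?_ ?_ ?_ ?_ S.2 T.2
  · exact isClosed_eq (by fun_prop) (by fun_prop)
  · intro a b a' b'
    rw [mul_mul_mul_of_commute h, mul_mul_mul_of_commute h, hφτ, hφτ, h₁.map_mul_comm,
      h₂.map_mul_comm]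
  · simp
  · simp
  · intro S S' T h h'
    simp only [add_mul, mul_add, map_add, h, h']
  · intro S S' T h h'
    simp only [add_mul, mul_add, map_add, h, h']

variable (ρ₁ ρ₂) in
/-- The C*-algebra generated by two commuting *-homomorphisms, with the trace obtained by
restriction of a state that is a product of traces. -/
theorem exists_trace_of_commute (h : ∀ a b, Commute (ρ₁ a) (ρ₂ b)) {τ₁ : 𝒜₁ →ₗ[ℂ] ℂ}
    {τ₂ : 𝒜₂ →ₗ[ℂ] ℂ} (h₁ : IsTrace τ₁) (h₂ : IsTrace τ₂) {φ : ℬ →L[ℂ] ℂ}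
    (hφ : IsState φ.toLinearMap) (hφτ : ∀ a b, φ (ρ₁ a * ρ₂ b) = τ₁ a * τ₂ b) :
    ∃ (𝒞 : Type u) (_ : CStarAlgebra 𝒞) (τ : 𝒞 →ₗ[ℂ] ℂ) (σ₁ : 𝒜₁ →⋆ₐ[ℂ] 𝒞) (σ₂ : 𝒜₂ →⋆ₐ[ℂ] 𝒞),
      IsTrace τ ∧ (∀ a b, Commute (σ₁ a) (σ₂ b)) ∧ (∀ a b, τ (σ₁ a * σ₂ b) = τ₁ a * τ₂ b) ∧
      (FiniteDimensional ℂ 𝒜₁ → FiniteDimensional ℂ 𝒜₂ → FiniteDimensional ℂ 𝒞) ∧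
      ((∀ u v : 𝒜₁, u * v = v * u) → (∀ u v : 𝒜₂, u * v = v * u) → ∀ u v : 𝒞, u * v = v * u) :=
  ⟨tensorClosure ρ₁ ρ₂ h, inferInstance,
    φ.toLinearMap ∘ₗ (tensorClosure ρ₁ ρ₂ h).subtype.toAlgHom.toLinearMap,
    ρ₁.codRestrict (tensorClosure ρ₁ ρ₂ h) left_mem_tensorClosure,
    ρ₂.codRestrict (tensorClosure ρ₁ ρ₂ h) right_mem_tensorClosure,
    isTrace_restrict_tensorClosure h₁ h₂ hφ hφτ, fun a b => Subtype.ext (h a b).eq, hφτ,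
    fun _ _ => finiteDimensional_tensorClosure,
    fun c₁ c₂ S T => Subtype.ext (mul_comm_of_mem_tensorClosure c₁ c₂ S.2 T.2)⟩

end StarRange

/-- The functional `T ↦ ⟪ξ, T ξ⟫`. -/
def vectorFunctional {H : Type u} [NormedAddCommGroup H] [InnerProductSpace ℂ H] (ξ : H) :
    (H →L[ℂ] H) →L[ℂ] ℂ :=
  (innerSL ℂ ξ).comp (ContinuousLinearMap.apply ℂ H ξ)

@[simp]
theorem vectorFunctional_apply {H : Type u} [NormedAddCommGroup H] [InnerProductSpace ℂ H] (ξ : H)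
    (T : H →L[ℂ] H) : vectorFunctional ξ T = ⟪ξ, T ξ⟫_ℂ := rfl

theorem isState_vectorFunctional {H : Type u} [NormedAddCommGroup H] [InnerProductSpace ℂ H]
    [CompleteSpace H] {ξ : H} (hξ : ⟪ξ, ξ⟫_ℂ = 1) :
    IsState (𝒜 := H →L[ℂ] H) (vectorFunctional ξ).toLinearMap := by
  refine ⟨hξ, fun T => ?_⟩
  change 0 ≤ ⟪ξ, (star T * T) ξ⟫_ℂ
  rw [mul_apply_eq_comp,
    ContinuousLinearMap.star_eq_adjoint,
    ContinuousLinearMap.adjoint_inner_right, inner_self_eq_norm_sq_to_K]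
  rw [← RCLike.ofReal_pow]
  exact Complex.zero_le_real.mpr (sq_nonneg ‖T ξ‖)

open scoped TensorProduct in
/-- Two C*-algebras with traces map, with commuting ranges, into a C*-algebra with a trace that
restricts to the product of the given traces. -/
theorem exists_tensor_trace {𝒜₁ 𝒜₂ : Type u} [CStarAlgebra 𝒜₁] [CStarAlgebra 𝒜₂]
    {τ₁ : 𝒜₁ →ₗ[ℂ] ℂ} {τ₂ : 𝒜₂ →ₗ[ℂ] ℂ} (h₁ : IsTrace τ₁) (h₂ : IsTrace τ₂) :
    ∃ (ℬ : Type u) (_ : CStarAlgebra ℬ) (τ : ℬ →ₗ[ℂ] ℂ) (ρ₁ : 𝒜₁ →⋆ₐ[ℂ] ℬ) (ρ₂ : 𝒜₂ →⋆ₐ[ℂ] ℬ),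
      IsTrace τ ∧ (∀ a b, Commute (ρ₁ a) (ρ₂ b)) ∧ (∀ a b, τ (ρ₁ a * ρ₂ b) = τ₁ a * τ₂ b) ∧
      (FiniteDimensional ℂ 𝒜₁ → FiniteDimensional ℂ 𝒜₂ → FiniteDimensional ℂ ℬ) ∧
      ((∀ u v : 𝒜₁, u * v = v * u) → (∀ u v : 𝒜₂, u * v = v * u) → ∀ u v : ℬ, u * v = v * u) := by
  obtain ⟨H₁, _, _, _, π₁, ξ₁, hξ₁⟩ := h₁.isState.exists_cyclic_representation
  obtain ⟨H₂, _, _, _, π₂, ξ₂, hξ₂⟩ := h₂.isState.exists_cyclic_representation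
  -- The vector functional at `ξ₁ ⊗ ξ₂` factorizes over the two legs.
  have hφ : ∀ (S : H₁ →L[ℂ] H₁) (T : H₂ →L[ℂ] H₂),
      vectorFunctional ((ξ₁ ⊗ₜ[ℂ] ξ₂ : H₁ ⊗[ℂ] H₂) : HilbertTensor H₁ H₂)
        (ampLeft H₁ H₂ S * ampRight H₁ H₂ T) = ⟪ξ₁, S ξ₁⟫_ℂ * ⟪ξ₂, T ξ₂⟫_ℂ := fun S T => by
    rw [vectorFunctional_apply, mul_apply_eq_comp, ampRight_apply_tmul, ampLeft_apply_tmul,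
      UniformSpace.Completion.inner_coe, TensorProduct.inner_tmul]
  refine exists_trace_of_commute (ℬ := HilbertTensor H₁ H₂ →L[ℂ] HilbertTensor H₁ H₂)
    ((ampLeft H₁ H₂).comp π₁) ((ampRight H₁ H₂).comp π₂)
    (fun a b => commute_ampLeft_ampRight (π₁ a) (π₂ b)) h₁ h₂
    (isState_vectorFunctional (ξ := ((ξ₁ ⊗ₜ[ℂ] ξ₂ : H₁ ⊗[ℂ] H₂) : HilbertTensor H₁ H₂)) ?_)
    fun a b => ?_
  -- At `S = T = 1` the factorization says that `ξ₁ ⊗ ξ₂` is a unit vector.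
  · have := hφ 1 1
    rw [← map_one π₁, hξ₁, ← map_one π₂, hξ₂, h₁.isState.map_one, h₂.isState.map_one, map_one,
      map_one, map_one, map_one, mul_one, mul_one] at this
    exact this
  · rw [← hξ₁, ← hξ₂]
    exact hφ (π₁ a) (π₂ b)

/-! ### Images of reciprocal states under tracial correlations -/

/-! ### Relations and positivity of the generators of `C_{X,A}`. -/

section Generators

variable {X A : Type u} [Fintype X] [Fintype A]

/-- The inclusion of `C_{X,A}` in the algebra of block diagonal operators. -/
def BrownCuntz.incl (X A : Type u) [Fintype X] [Fintype A] :
    BrownCuntz X A →⋆ₐ[ℂ] BlockDiagonal X A :=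
  (brownCuntz X A).subtype

theorem BrownCuntz.incl_injective : Function.Injective (BrownCuntz.incl X A) :=
  Subtype.val_injective

/-- The element `v_{a,x} = ⊕_V V_{a,x}`. -/
def isometryBlock (a : A) (x : X) : BlockDiagonal X A :=
  ⟨fun V => V.V a x, memℓp_infty ⟨1, by
    rintro _ ⟨V, rfl⟩
    exact V.norm_le_one a x⟩⟩

theorem BrownCuntz.incl_gen (x x' : X) (a a' : A) :
    BrownCuntz.incl X A (gen x x' a a') = star (isometryBlock a x) * isometryBlock a' x' := rfl

theorem sum_gen_diag [DecidableEq X] (x x' : X) :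
    ∑ a, gen x x' a a = (if x = x' then 1 else 0 : BrownCuntz X A) := by
  apply BrownCuntz.incl_injective
  rw [map_sum]
  refine lp.ext (funext fun V => ?_)
  simp only [BrownCuntz.incl_gen]
  have h : (∑ a, star (isometryBlock a x) * isometryBlock a x' : BlockDiagonal X A) V =
      ∑ a, star (V.V a x) * V.V a x' := by
    rw [lp.coeFn_sum, Finset.sum_apply]
    rfl
  rw [h]
  split_ifs with hx
  · subst hx
    rw [V.sum_same, map_one]
    rfl
  · rw [V.sum_ne x x' hx, map_zero]
    rfl

/-- The matrix `(e_{x,x',a,a'})` over `C_{X,A}` is positive. -/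
theorem exists_gen_eq_gram : ∃ F : Matrix (X × A) (X × A) (BrownCuntz X A), ∀ x x' a a',
    gen x x' a a' = ∑ k, star (F k (x, a)) * F k (x', a') := by
  -- Among block diagonal operators the matrix is `v^* v` for the single row `v = (v_{a,x})`. The
  -- definition does not place the `v_{a,x}` in `C_{X,A}`, so the factorization is pulled back along
  -- the injective inclusion.
  obtain ⟨D, hD⟩ := exists_conjTranspose_mul_self_eq_gram
    (fun (_ : Unit) (p : X × A) => isometryBlock p.2 p.1)
  obtain ⟨F, hF⟩ := exists_conjTranspose_mul_self_of_map (BrownCuntz.incl X A)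
    BrownCuntz.incl_injective (M := Matrix.of fun p q => gen p.1 q.1 p.2 q.2) (D := D) (by
      rw [← hD]
      ext1 p q
      simp [BrownCuntz.incl_gen])
  exact ⟨F, fun x x' a a' => congrFun (congrFun hF (x, a)) (x', a')⟩

end Generators

/-! ### The stochastic matrix that represents the image state. -/

section Image

variable {X A 𝒜₁ 𝒜₂ ℬ : Type u} [Fintype X] [Fintype A] [CStarAlgebra 𝒜₁] [CStarAlgebra 𝒜₂]
  [CStarAlgebra ℬ]

/-- The matrix `h_{a,a'} = ∑_{x,x'} g_{x,x'} ⊗ e_{x,x',a,a'}`. -/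
def imageMatrix (ρ₁ : 𝒜₁ →⋆ₐ[ℂ] ℬ) (ρ : BrownCuntz X A →⋆ₐ[ℂ] ℬ) (E : Matrix X X 𝒜₁) :
    Matrix A A ℬ :=
  Matrix.of fun a a' => ∑ x, ∑ x', ρ₁ (E x x') * ρ (gen x x' a a')

theorem isStochasticMatrix_imageMatrix {ρ₁ : 𝒜₁ →⋆ₐ[ℂ] ℬ} {ρ : BrownCuntz X A →⋆ₐ[ℂ] ℬ}
    (h : ∀ a b, Commute (ρ₁ a) (ρ b)) {E : Matrix X X 𝒜₁} (hE : IsStochasticMatrix E) :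
    IsStochasticMatrix (imageMatrix ρ₁ ρ E) := by
  classical
  constructor
  · obtain ⟨D, rfl⟩ := hE.positive
    obtain ⟨F, hF⟩ := exists_gen_eq_gram (X := X) (A := A)
    -- If `E = D^* D` and `(e_{x,x',a,a'}) = F^* F`, then by commutation `h` is the Gram matrix of
    -- the rows `a ↦ ∑_x ρ₁(D_{i,x}) ρ(F_{j,(x,a)})`, indexed by `(i, j)`.
    obtain ⟨G, hG⟩ := exists_conjTranspose_mul_self_eq_gram
      (fun (k : X × (X × A)) (a : A) => ∑ x, ρ₁ (D k.1 x) * ρ (F k.2 (x, a)))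
    refine ⟨G, ?_⟩
    rw [← hG]
    ext a a'
    have hcomm : ∀ d f d' f', star (ρ₁ d * ρ f) * (ρ₁ d' * ρ f') =
        ρ₁ (star d * d') * ρ (star f * f') := fun d f d' f' => by
      rw [star_mul, map_mul, map_mul, map_star, map_star, ← map_star, ← map_star,
        ← (h (star d) (star f)).eq, mul_assoc, ← mul_assoc (ρ (star f)), ← (h d' (star f)).eq]
      simp only [mul_assoc]
    simp only [imageMatrix, Matrix.of_apply, Matrix.mul_apply, Matrix.conjTranspose_apply, hF,
      map_sum, star_sum, Finset.sum_mul_sum, hcomm, Fintype.sum_prod_type (α₁ := X) (α₂ := X × A)]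
    have hswap : ∀ f : X → X → X → X × A → ℬ,
        ∑ x, ∑ x', ∑ i, ∑ j, f x x' i j = ∑ i, ∑ j, ∑ x, ∑ x', f x x' i j := fun f => by
      have := Finset.sum_comm (s := Finset.univ) (t := Finset.univ)
        (f := fun (p : X × X) (q : X × (X × A)) => f p.1 p.2 q.1 q.2)
      simpa only [Fintype.sum_prod_type (α₁ := X) (α₂ := X),
        Fintype.sum_prod_type (α₁ := X) (α₂ := X × A)] using this
    exact hswap _
  · simp only [Matrix.trace, Matrix.diag, imageMatrix, Matrix.of_apply]
    rw [Finset.sum_comm]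
    -- Summing over `a` turns the generators into `δ_{x,x'}`, which leaves only the diagonal of `E`.
    have : ∀ x, ∑ a : A, ∑ x', ρ₁ (E x x') * ρ (gen x x' a a) = ρ₁ (E x x) := fun x => by
      rw [Finset.sum_comm]
      simp only [← Finset.mul_sum, ← map_sum, sum_gen_diag, apply_ite ρ, map_one, map_zero]
      simp
    simp only [this, ← map_sum]
    have := hE.trace_eq_one
    simp only [Matrix.trace, Matrix.diag] at this
    rw [this, map_one]

/-- Commutation regroups `h_{a,a'} h_{b',b}` into terms `ρ₁(g g') ρ₂(e e')`, on which `τ` splits as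
`τ₁` times `τ₂`. Traciality plays no role in this identity. -/
theorem tracialMap_reciprocalMatrix {τ₁ : 𝒜₁ →ₗ[ℂ] ℂ} {τ₂ : 𝒜₂ →ₗ[ℂ] ℂ} {τ : ℬ →ₗ[ℂ] ℂ}
    {ρ₁ : 𝒜₁ →⋆ₐ[ℂ] ℬ} {ρ₂ : 𝒜₂ →⋆ₐ[ℂ] ℬ} (h : ∀ a b, Commute (ρ₁ a) (ρ₂ b))
    (hτ : ∀ a b, τ (ρ₁ a * ρ₂ b) = τ₁ a * τ₂ b) (π : BrownCuntz X A →⋆ₐ[ℂ] 𝒜₂)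
    (E : Matrix X X 𝒜₁) :
    tracialMap (τ₂ ∘ₗ π.toAlgHom.toLinearMap) (reciprocalMatrix E τ₁) =
      reciprocalMatrix (imageMatrix ρ₁ (ρ₂.comp π) E) τ := by
  ext p q
  simp only [tracialMap, reciprocalMatrix, imageMatrix, LinearMap.coe_mk, AddHom.coe_mk,
    Matrix.of_apply, StarAlgHom.comp_apply, Finset.sum_mul_sum, mul_mul_mul_of_commute h,
    map_sum, hτ]
  refine Finset.sum_congr rfl fun x _ => ?_
  -- Multiplying out gives the summation order `x, y', x', y`, against `x, x', y, y'` in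
  -- `tracialMap`.
  rw [Finset.sum_comm (s := Finset.univ (α := X)) (t := Finset.univ (α := X))
    (f := fun y' x' => ∑ y, τ₁ (E x x' * E y' y) * τ₂ (π (gen x x' p.1 q.1) * π (gen y' y q.2 p.2)))]
  refine Finset.sum_congr rfl fun x' _ => ?_
  rw [Finset.sum_comm]
  refine Finset.sum_congr rfl fun y' _ => Finset.sum_congr rfl fun y _ => ?_
  rw [← map_mul π]
  rfl

end Image

theorem IsQNSCorrelation.isMatrixState_map {X Y A B : Type u} [Fintype X] [Fintype Y] [Fintype A]
    [Fintype B] {Γ : Matrix (X × Y) (X × Y) ℂ →ₗ[ℂ] Matrix (A × B) (A × B) ℂ}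
    (hΓ : IsQNSCorrelation Γ) {ω : Matrix (X × Y) (X × Y) ℂ} (hω : IsMatrixState ω) :
    IsMatrixState (Γ ω) := by
  refine ⟨?_, by rw [hΓ.isQuantumChannel.trace_preserving, hω.2]⟩
  -- Positivity of `Γ` is complete positivity at `n = 1`, up to the index set `Fin 1`.
  have := hΓ.isQuantumChannel.completelyPositive 1 _ (hω.1.submatrix (Prod.snd : Fin 1 × (X × Y) → _))
  exact this.submatrix (fun p : A × B => ((0 : Fin 1), p))

/-- The common core of the three cases; the last two clauses record what the quantum and local cases
need of `ℬ`. -/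
theorem exists_reciprocalMatrix_eq_tracialMap {X A 𝒜₁ 𝒜₂ : Type u} [Fintype X] [Fintype A]
    [CStarAlgebra 𝒜₁] [CStarAlgebra 𝒜₂] {τ₁ : 𝒜₁ →ₗ[ℂ] ℂ} {τ₂ : 𝒜₂ →ₗ[ℂ] ℂ} (h₁ : IsTrace τ₁)
    (h₂ : IsTrace τ₂) (π : BrownCuntz X A →⋆ₐ[ℂ] 𝒜₂) {E : Matrix X X 𝒜₁}
    (hE : IsStochasticMatrix E) :
    ∃ (ℬ : Type u) (_ : CStarAlgebra ℬ) (τ : ℬ →ₗ[ℂ] ℂ) (G : Matrix A A ℬ),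
      IsTrace τ ∧ IsStochasticMatrix G ∧
      tracialMap (τ₂ ∘ₗ π.toAlgHom.toLinearMap) (reciprocalMatrix E τ₁) = reciprocalMatrix G τ ∧
      (FiniteDimensional ℂ 𝒜₁ → FiniteDimensional ℂ 𝒜₂ → FiniteDimensional ℂ ℬ) ∧
      ((∀ u v : 𝒜₁, u * v = v * u) → (∀ u v : 𝒜₂, u * v = v * u) → ∀ u v : ℬ, u * v = v * u) := by
  obtain ⟨ℬ, _, τ, ρ₁, ρ₂, hτ, h, hmul, hfin, hcomm⟩ := exists_tensor_trace h₁ h₂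
  exact ⟨ℬ, _, τ, imageMatrix ρ₁ (ρ₂.comp π) E, hτ,
    isStochasticMatrix_imageMatrix (fun a b => h a (π b)) hE,
    tracialMap_reciprocalMatrix h hmul π E, hfin, hcomm⟩

end QNS

end

theorem theorem8p10 {X A : Type u} [Fintype X] [Fintype A]
    (Γ : Matrix (X × X) (X × X) ℂ →ₗ[ℂ] Matrix (A × A) (A × A) ℂ)
    (hΓ : QNS.IsQNSCorrelation Γ) :
    (QNS.IsTracial Γ → Γ '' QNS.reciprocalStates X ⊆ QNS.reciprocalStates A) ∧
    (QNS.IsQuantumTracial Γ →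
      Γ '' QNS.quantumReciprocalStates X ⊆ QNS.quantumReciprocalStates A) ∧
    (QNS.IsLocallyTracial Γ →
      Γ '' QNS.locallyReciprocalStates X ⊆ QNS.locallyReciprocalStates A) := by
  refine ⟨?_, ?_, ?_⟩
  · rintro ⟨-, τ₂, h₂, hΓτ⟩ _ ⟨_, ⟨hω, 𝒜₁, _, τ₁, E, h₁, hE, rfl⟩, rfl⟩
    -- The trace lives on `C_{X,A}` itself, so `π` is the identity.
    obtain ⟨ℬ, _, τ, G, hτ, hG, h, -, -⟩ :=
      QNS.exists_reciprocalMatrix_eq_tracialMap h₁ h₂ (StarAlgHom.id ℂ (QNS.BrownCuntz X A)) hE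
    exact ⟨hΓ.isMatrixState_map hω, ℬ, _, τ, G, hτ, hG, hΓτ ▸ h⟩
  · rintro ⟨-, 𝒜₂, _, τ₂, π, hfin₂, h₂, hΓτ⟩ _ ⟨_, ⟨hω, 𝒜₁, _, τ₁, E, hfin₁, h₁, hE, rfl⟩, rfl⟩
    obtain ⟨ℬ, _, τ, G, hτ, hG, h, hfin, -⟩ :=
      QNS.exists_reciprocalMatrix_eq_tracialMap h₁ h₂ π hE
    exact ⟨hΓ.isMatrixState_map hω, ℬ, _, τ, G, hfin hfin₁ hfin₂, hτ, hG, hΓτ ▸ h⟩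
  · rintro ⟨-, 𝒜₂, _, τ₂, π, hcomm₂, h₂, hΓτ⟩ _ ⟨_, ⟨hω, 𝒜₁, _, τ₁, E, hcomm₁, h₁, hE, rfl⟩, rfl⟩
    -- A state on an abelian algebra is automatically a trace.
    obtain ⟨ℬ, _, τ, G, hτ, hG, h, -, hcomm⟩ :=
      QNS.exists_reciprocalMatrix_eq_tracialMap h₁ ⟨h₂, fun a b => by rw [hcomm₂]⟩ π hE
    exact ⟨hΓ.isMatrixState_map hω, ℬ, _, τ, G, hcomm hcomm₁ hcomm₂, hτ, hG, hΓτ ▸ h⟩
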